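/- Let $(\mathcal X,\mathcal A,\mathcal R,\mathcal P,\gamma)$ be a discounted Markov decision process with measurable state space $\mathcal X$, finite nonempty action set $\mathcal A$, reward distributions $\mathcal R(\cdot|x,a)$ with finite and uniformly bounded mean $r(x,a)$, transition kernel $\mathcal P$ and discount factor $0\le\gamma<1$. Let $\rho$ be an initial probability distribution on $\mathcal X$. For $\theta\in\mathbb R^d$ let $$\pi_\theta(a|x)=\frac{\exp(\phi(a|x)^\top\theta)}{\sum_{a'\in\mathcal A}\exp(\phi(a'|x)^\top\theta)},\qquad B=\sup_{x,a}\|\phi(a|x)\|_2<\infty ,$$ with features $\phi(a|\cdot):\mathcal X\to\mathbb R^d$ measurable. For a transition kernel $\mathcal P_1$ write $\mathcal P_1^{\pi_\theta}(\cdot|x)=\sum_a\pi_\theta(a|x)\mathcal P_1(\cdot|x,a)$, and let $Q^{\pi_\theta}(x,a)=\mathbb E\big[\sum_{t\ge0}\gamma^t r(X_t,A_t)\,\big|\,X_0=x,A_0=a\big]$ be the action-value function of $\pi_\theta$ under the true dynamics $\mathcal P$. For a Markov kernel $\mathcal K$ on $\mathcal X$ with $k$-fold iterates $\mathcal K^k$,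 define $$\nabla_\theta J(\pi_\theta;\mathcal K)=\sum_{k\ge0}\gamma^k\int\rho(dx)\int\mathcal K^k(dx'|x)\sum_{a\in\mathcal A}\nabla_\theta\pi_\theta(a|x')\,Q^{\pi_\theta}(x',a);$$ thus $\nabla_\theta J(\pi_\theta;\mathcal P^{\pi_\theta})$ is the policy gradient of $\pi_\theta$ in the true process. Let $\Theta\subset\mathbb R^d$ and suppose $|Q^{\pi_\vartheta}(x,a)|\le Q_{\max}$ for all $\vartheta\in\Theta$ and all $(x,a)$. Let $\theta,\theta'\in\Theta$ and let $\hat{\mathcal P}$ be a transition kernel (the model learned at $\theta$) whose PAML error at $\theta$ satisfies $$\big\|\nabla_\theta J(\pi_\theta;\mathcal P^{\pi_\theta})-\nabla_\theta J(\pi_\theta;\hat{\mathcal P}^{\pi_\theta})\big\|_2\le\varepsilon_{\mathrm{model}} .$$ Then $$\big\|\nabla_\theta J(\pi_{\theta'};\mathcal P^{\pi_{\theta'}})-\nabla_\theta J(\pi_{\theta'};\hat{\mathcal P}^{\pi_\theta})\big\|_2\le\varepsilon_{\mathrm{model}}+c_1\|\theta-\theta'\|_2,\qquad c_1=\frac{Q_{\max}B^2|\mathcal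 A|}{1-\gamma}\Big[12+\frac{4\gamma(1+2|\mathcal A|)}{1-\gamma}\Big].$$ -/

import Mathlib

open MeasureTheory ProbabilityTheory

namespace PAML

noncomputable section

variable {X A : Type*} [MeasurableSpace X] [Fintype A] [MeasurableSpace A] {d : ℕ}

/-- The exponential policy with features `φ(a|x) ∈ ℝ^d` and a finite action space:
`π_θ(a|x) = exp(φ(a|x)ᵀ θ) / ∑_{a'} exp(φ(a'|x)ᵀ θ)`. -/
def expPolicy (φ : X → A → EuclideanSpace ℝ (Fin d)) (θ : EuclideanSpace ℝ (Fin d))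
    (x : X) (a : A) : ℝ :=
  Real.exp (inner ℝ (φ x a) θ) / ∑ a' : A, Real.exp (inner ℝ (φ x a') θ)

theorem measurable_expPolicy {X A : Type*} [MeasurableSpace X] [Fintype A] {d : ℕ}
    (φ : X → A → EuclideanSpace ℝ (Fin d)) (hφ : ∀ a, Measurable fun x => φ x a)
    (θ : EuclideanSpace ℝ (Fin d)) (a : A) : Measurable fun x => expPolicy φ θ x a := by
  have h : ∀ b, Measurable fun x => Real.exp (inner ℝ (φ x b) θ) := fun b =>
    Real.measurable_exp.comp ((hφ b).inner_const)
  exact (h a).div (Finset.measurable_sum _ fun b _ => h b)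

/-- The exponential policy as a kernel: given the state `x`, the action `a` is drawn with
probability `π_θ(a|x)`. -/
def policyKernel (φ : X → A → EuclideanSpace ℝ (Fin d)) (hφ : ∀ a, Measurable fun x => φ x a)
    (θ : EuclideanSpace ℝ (Fin d)) : Kernel X A where
  toFun x := ∑ a : A, ENNReal.ofReal (expPolicy φ θ x a) • Measure.dirac a
  measurable' := by
    refine Measure.measurable_of_measurable_coe _ fun s _ => ?_
    simp only [Measure.coe_finsetSum, Finset.sum_apply, Measure.smul_apply, smul_eq_mul]
    refine Finset.measurable_sum _ fun a _ => ?_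
    exact (measurable_expPolicy φ hφ θ a).ennreal_ofReal.mul_const _

/-- `P^π(·|x) = ∑_a π(a|x) P(·|x,a)`: the state transition kernel obtained by following the
policy `π` in the dynamics `P`. -/
def stateKernel (P : Kernel (X × A) X) (π : Kernel X A) : Kernel X X :=
  P ∘ₖ (Kernel.id ×ₖ π)

/-- The one-step kernel of the state-action process: `X' ~ P(·|x,a)`, then `A' ~ π(·|X')`. -/
def stateActionKernel (P : Kernel (X × A) X) (π : Kernel X A) : Kernel (X × A) (X × A) :=
  (Kernel.id ×ₖ π) ∘ₖ P

/-- The expected reward `r(x,a)`, the mean of the reward distribution `R(·|x,a)`. -/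
def expReward (R : Kernel (X × A) ℝ) (z : X × A) : ℝ :=
  ∫ u, u ∂(R z)

/-- The action-value function `Q^π(x,a) = ∑_t γ^t E[r(X_t,A_t) | X_0 = x, A_0 = a]`; the law of
`(X_t,A_t)` is the `t`-th power (for composition) of the one-step state-action kernel. -/
def actionValue (R : Kernel (X × A) ℝ) (P : Kernel (X × A) X) (γ : ℝ) (π : Kernel X A)
    (x : X) (a : A) : ℝ :=
  ∑' t : ℕ, γ ^ t * ∫ z, expReward R z ∂((stateActionKernel P π ^ t) (x, a))

/-- The policy gradient of `π_ϑ` computed along the state kernel `K`, with the critic `Q^{π_ϑ}` of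
the true process `(R, P, γ)`:
`∇J(π_ϑ; K) = ∑_k γ^k ∫ ρ(dx) ∫ K^k(dx'|x) ∑_a ∇_ϑ π_ϑ(a|x') Q^{π_ϑ}(x',a)`. -/
def policyGrad (R : Kernel (X × A) ℝ) (P : Kernel (X × A) X) (γ : ℝ) (ρ : Measure X)
    (φ : X → A → EuclideanSpace ℝ (Fin d)) (hφ : ∀ a, Measurable fun x => φ x a)
    (ϑ : EuclideanSpace ℝ (Fin d)) (K : Kernel X X) : EuclideanSpace ℝ (Fin d) :=
  ∑' k : ℕ, γ ^ k • ∫ x, ∫ x', ∑ a : A,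
    actionValue R P γ (policyKernel φ hφ ϑ) x' a • gradient (fun η => expPolicy φ η x' a) ϑ
      ∂((K ^ k) x) ∂ρ

/-- The PAML loss at `θ` of the model `Phat`: the `ℓ²` distance between the policy gradients of
`π_θ` computed along the true state kernel `P^{π_θ}` and along the model's `Phat^{π_θ}`. -/
def pamlLoss (R : Kernel (X × A) ℝ) (P Phat : Kernel (X × A) X) (γ : ℝ) (ρ : Measure X)
    (φ : X → A → EuclideanSpace ℝ (Fin d)) (hφ : ∀ a, Measurable fun x => φ x a)
    (θ : EuclideanSpace ℝ (Fin d)) : ℝ :=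
  ‖policyGrad R P γ ρ φ hφ θ (stateKernel P (policyKernel φ hφ θ)) -
    policyGrad R P γ ρ φ hφ θ (stateKernel Phat (policyKernel φ hφ θ))‖

end

end PAML

namespace PAML

/-! Write `∇J(π_ϑ; K)` as the `ρ`-integral of the resolvent `(I - γK)⁻¹` applied to the integrand
`g_ϑ = ∑_a Q^{π_ϑ} ∇π_ϑ`. Pass from the true gradient at `θ'` to the model gradient at `θ'` in four
moves: change the kernel `P^{π_θ'}` to `P^{π_θ}`, change the integrand `g_θ'` to `g_θ`, replace `P`
by `Phat` (cost `εmodel`), and change the integrand back along the model kernel.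

Kernel changes rest on `norm_resolvent_sub_resolvent_le`: with `V = f + γKV` and `V' = f + γK'V'`,
one has `V' - V = γ((K' - K)V' + K(V' - V))`, so a sup bound `M` on `(K' - K)V'` gives `γM/(1 - γ)`.
This serves twice: for state kernels, and for state-action kernels, whose resolvent of the reward is
`Q`. Integrand changes combine this Lipschitz bound on `Q` with softmax estimates from `∇π = π(φ -
mean φ)`. The reward bound only secures convergence and integrability; the constant sees `Qmax`
alone. -/

theorem le_div_one_sub_of_contraction {X : Type*} {u : X → ℝ} {γ M : ℝ} (hγ1 : γ < 1)
    (hu : BddAbove (Set.range u))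
    (h : ∀ D, (∀ x, u x ≤ D) → ∀ x, u x ≤ γ * (M + D)) (x : X) : u x ≤ γ * M / (1 - γ) := by
  have : Nonempty X := ⟨x⟩
  -- The best bound `D` is the supremum itself; boundedness makes it finite, so it can be absorbed
  -- on the left.
  have h1 : (⨆ y, u y) ≤ γ * (M + ⨆ y, u y) := ciSup_le (h _ fun y => le_ciSup hu y)
  refine (le_ciSup hu x).trans ?_
  rw [le_div_iff₀ (by linarith)]
  linarith

/-! ### Discounted resolvents of Markov kernels -/

section Resolvent

variable {X E : Type*} [MeasurableSpace X] [NormedAddCommGroup E] [NormedSpace ℝ E]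

instance isMarkovKernel_pow (K : Kernel X X) [IsMarkovKernel K] (k : ℕ) :
    IsMarkovKernel (K ^ k) := by
  induction k with
  | zero => exact inferInstanceAs (IsMarkovKernel (Kernel.id : Kernel X X))
  | succ k ih => rw [pow_succ]; exact inferInstanceAs (IsMarkovKernel ((K ^ k) ∘ₖ K))

theorem norm_integral_le_of_forall_norm_le {Y : Type*} [MeasurableSpace Y] (μ : Measure Y)
    [IsProbabilityMeasure μ] {f : Y → E} {C : ℝ} (hC : ∀ x, ‖f x‖ ≤ C) :
    ‖∫ x, f x ∂μ‖ ≤ C := by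
  simpa using norm_integral_le_of_norm_le_const (μ := μ) (Filter.Eventually.of_forall hC)

theorem integrable_of_forall_norm_le {Y F : Type*} [MeasurableSpace Y] [NormedAddCommGroup F]
    (μ : Measure Y) [IsFiniteMeasure μ] {f : Y → F} (hf : StronglyMeasurable f) {C : ℝ}
    (hC : ∀ x, ‖f x‖ ≤ C) :
    Integrable f μ :=
  .of_bound hf.aestronglyMeasurable C (Filter.Eventually.of_forall hC)

/-- The discounted resolvent `∑_k γ^k K^k f` of a kernel applied to a function. -/
noncomputable def resolvent (K : Kernel X X) (γ : ℝ) (f : X → E) (x : X) : E :=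
  ∑' k : ℕ, γ ^ k • ∫ y, f y ∂((K ^ k) x)

variable {γ : ℝ} {f : X → E} {C : ℝ}

theorem hasSum_geometric_mul (hγ0 : 0 ≤ γ) (hγ1 : γ < 1) (C : ℝ) :
    HasSum (fun k : ℕ => γ ^ k * C) (C / (1 - γ)) := by
  simpa [div_eq_inv_mul] using (hasSum_geometric_of_lt_one hγ0 hγ1).mul_right C

theorem stronglyMeasurable_resolvent_term (L : Kernel X X) (hf : StronglyMeasurable f) (k : ℕ) :
    StronglyMeasurable fun x => γ ^ k • ∫ y, f y ∂((L ^ k) x) :=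
  (hf.integral_kernel (κ := L ^ k)).const_smul (γ ^ k)

variable (K : Kernel X X) [IsMarkovKernel K]

theorem norm_resolvent_term_le (hγ0 : 0 ≤ γ) (hC : ∀ x, ‖f x‖ ≤ C) (k : ℕ) (x : X) :
    ‖γ ^ k • ∫ y, f y ∂((K ^ k) x)‖ ≤ γ ^ k * C := by
  rw [norm_smul, Real.norm_of_nonneg (pow_nonneg hγ0 k)]
  exact mul_le_mul_of_nonneg_left (norm_integral_le_of_forall_norm_le _ hC) (pow_nonneg hγ0 k)

theorem norm_resolvent_le (hγ0 : 0 ≤ γ) (hγ1 : γ < 1) (hC : ∀ x, ‖f x‖ ≤ C) (x : X) :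
    ‖resolvent K γ f x‖ ≤ C / (1 - γ) :=
  tsum_of_norm_bounded (hasSum_geometric_mul hγ0 hγ1 C)
    fun k => norm_resolvent_term_le K hγ0 hC k x

theorem summable_resolvent [CompleteSpace E] (hγ0 : 0 ≤ γ) (hγ1 : γ < 1)
    (hC : ∀ x, ‖f x‖ ≤ C) (x : X) : Summable fun k : ℕ => γ ^ k • ∫ y, f y ∂((K ^ k) x) :=
  .of_norm_bounded (hasSum_geometric_mul hγ0 hγ1 C).summable
    fun k => norm_resolvent_term_le K hγ0 hC k x

theorem stronglyMeasurable_resolvent [CompleteSpace E] (hγ0 : 0 ≤ γ) (hγ1 : γ < 1)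
    (hf : StronglyMeasurable f) (hC : ∀ x, ‖f x‖ ≤ C) :
    StronglyMeasurable (resolvent K γ f) := by
  refine stronglyMeasurable_of_tendsto Filter.atTop
    (fun n : ℕ => Finset.stronglyMeasurable_fun_sum (Finset.range n)
      fun k _ => stronglyMeasurable_resolvent_term (γ := γ) K hf k) ?_
  exact tendsto_pi_nhds.2 fun x => (summable_resolvent K hγ0 hγ1 hC x).hasSum.tendsto_sum_nat

/-- Geometric domination permits exchanging sum and integral. With `μ = ρ` this represents the
policy gradient; with `μ = K x` it yields the resolvent equation. -/
theorem hasSum_integral_resolvent [CompleteSpace E] (hγ0 : 0 ≤ γ) (hγ1 : γ < 1)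
    (hf : StronglyMeasurable f) (hC : ∀ x, ‖f x‖ ≤ C) (μ : Measure X) [IsProbabilityMeasure μ] :
    HasSum (fun k : ℕ => γ ^ k • ∫ x, ∫ y, f y ∂((K ^ k) x) ∂μ) (∫ x, resolvent K γ f x ∂μ) := by
  have hswap : (fun k : ℕ => γ ^ k • ∫ x, ∫ y, f y ∂((K ^ k) x) ∂μ) =
      fun k : ℕ => ∫ x, γ ^ k • ∫ y, f y ∂((K ^ k) x) ∂μ :=
    funext fun k => (integral_smul _ _).symm
  rw [hswap]
  refine hasSum_integral_of_summable_integral_norm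
    (fun k => integrable_of_forall_norm_le μ (stronglyMeasurable_resolvent_term K hf k)
      (norm_resolvent_term_le K hγ0 hC k)) ?_
  refine .of_norm_bounded (hasSum_geometric_mul hγ0 hγ1 C).summable fun k => ?_
  refine norm_integral_le_of_forall_norm_le μ fun x => ?_
  rw [norm_norm]
  exact norm_resolvent_term_le K hγ0 hC k x

/-- Split off the term `k = 0` and factor one step of `K` out of each remaining power. -/
theorem resolvent_eq_add [CompleteSpace E] (hγ0 : 0 ≤ γ) (hγ1 : γ < 1)
    (hf : StronglyMeasurable f) (hC : ∀ x, ‖f x‖ ≤ C) (x : X) :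
    resolvent K γ f x = f x + γ • ∫ y, resolvent K γ f y ∂(K x) := by
  rw [resolvent, (summable_resolvent K hγ0 hγ1 hC x).tsum_eq_zero_add,
    ← (hasSum_integral_resolvent K hγ0 hγ1 hf hC (K x)).tsum_eq, ← tsum_const_smul'']
  congr 1
  · have : (K ^ 0) x = Measure.dirac x := by
      rw [pow_zero]; exact Kernel.id_apply x
    rw [this, integral_dirac' _ _ hf, pow_zero, one_smul]
  · refine tsum_congr fun k => ?_
    rw [Kernel.pow_add, pow_one, Kernel.integral_comp, pow_succ', mul_smul]
    exact integrable_of_forall_norm_le _ hf hC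

/-- Perturbation of the resolvent in the kernel. -/
theorem norm_resolvent_sub_resolvent_le [CompleteSpace E] (K' : Kernel X X) [IsMarkovKernel K']
    (hγ0 : 0 ≤ γ) (hγ1 : γ < 1) (hf : StronglyMeasurable f) (hC : ∀ x, ‖f x‖ ≤ C) {M : ℝ}
    (hM : ∀ x, ‖∫ y, resolvent K' γ f y ∂(K' x) - ∫ y, resolvent K' γ f y ∂(K x)‖ ≤ M) (x : X) :
    ‖resolvent K' γ f x - resolvent K γ f x‖ ≤ γ * M / (1 - γ) := by
  refine le_div_one_sub_of_contraction
    (u := fun x => ‖resolvent K' γ f x - resolvent K γ f x‖) hγ1 ?_ ?_ x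
  -- This crude bound only makes the supremum finite; it does not enter the estimate.
  · refine ⟨C / (1 - γ) + C / (1 - γ), ?_⟩
    rintro _ ⟨y, rfl⟩
    exact (norm_sub_le _ _).trans (add_le_add (norm_resolvent_le K' hγ0 hγ1 hC y)
      (norm_resolvent_le K hγ0 hγ1 hC y))
  · intro D hD y
    have hi : ∀ (L : Kernel X X) [IsMarkovKernel L], Integrable (resolvent L γ f) (K y) :=
      fun L _ => integrable_of_forall_norm_le _ (stronglyMeasurable_resolvent L hγ0 hγ1 hf hC)
        (norm_resolvent_le L hγ0 hγ1 hC)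
    have key : resolvent K' γ f y - resolvent K γ f y =
        γ • ((∫ z, resolvent K' γ f z ∂(K' y) - ∫ z, resolvent K' γ f z ∂(K y)) +
          ∫ z, (resolvent K' γ f z - resolvent K γ f z) ∂(K y)) := by
      rw [integral_sub (hi K') (hi K), sub_add_sub_cancel, resolvent_eq_add K' hγ0 hγ1 hf hC y,
        resolvent_eq_add K hγ0 hγ1 hf hC y, add_sub_add_left_eq_sub, smul_sub]
    rw [key, norm_smul, Real.norm_of_nonneg hγ0]
    exact mul_le_mul_of_nonneg_left ((norm_add_le _ _).trans
      (add_le_add (hM y) (norm_integral_le_of_forall_norm_le _ hD))) hγ0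

theorem resolvent_sub [CompleteSpace E] (hγ0 : 0 ≤ γ) (hγ1 : γ < 1) {g : X → E} {C' : ℝ}
    (hf : StronglyMeasurable f) (hg : StronglyMeasurable g)
    (hC : ∀ x, ‖f x‖ ≤ C) (hC' : ∀ x, ‖g x‖ ≤ C') (x : X) :
    resolvent K γ (fun y => f y - g y) x = resolvent K γ f x - resolvent K γ g x := by
  rw [resolvent, resolvent, resolvent, ← (summable_resolvent K hγ0 hγ1 hC x).tsum_sub
    (summable_resolvent K hγ0 hγ1 hC' x)]
  refine tsum_congr fun k => ?_
  rw [integral_sub (integrable_of_forall_norm_le _ hf hC) (integrable_of_forall_norm_le _ hg hC'),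
    smul_sub]

end Resolvent

/-! ### Softmax estimates -/

section ExpPolicy

variable {X A : Type*} [Fintype A] {d : ℕ} (φ : X → A → EuclideanSpace ℝ (Fin d))

theorem expPolicy_nonneg (θ : EuclideanSpace ℝ (Fin d)) (x : X) (a : A) :
    0 ≤ expPolicy φ θ x a := by
  unfold expPolicy; positivity

theorem sum_exp_inner_pos [Nonempty A] (θ : EuclideanSpace ℝ (Fin d)) (x : X) :
    0 < ∑ a, Real.exp (inner ℝ (φ x a) θ) :=
  Finset.sum_pos (fun _ _ => Real.exp_pos _) Finset.univ_nonempty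

theorem sum_expPolicy [Nonempty A] (θ : EuclideanSpace ℝ (Fin d)) (x : X) :
    ∑ a, expPolicy φ θ x a = 1 := by
  unfold expPolicy
  rw [← Finset.sum_div, div_self (sum_exp_inner_pos φ θ x).ne']

theorem expPolicy_le_one [Nonempty A] (θ : EuclideanSpace ℝ (Fin d)) (x : X) (a : A) :
    expPolicy φ θ x a ≤ 1 :=
  (Finset.single_le_sum (fun b _ => expPolicy_nonneg φ θ x b) (Finset.mem_univ a)).trans_eq
    (sum_expPolicy φ θ x)

/-- The mean feature vector `∑_a π_θ(a|x) φ(a|x)`. -/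
noncomputable def meanFeature (θ : EuclideanSpace ℝ (Fin d)) (x : X) :
    EuclideanSpace ℝ (Fin d) :=
  ∑ a, expPolicy φ θ x a • φ x a

theorem hasGradientAt_expPolicy [Nonempty A] (θ : EuclideanSpace ℝ (Fin d)) (x : X) (a : A) :
    HasGradientAt (fun η => expPolicy φ η x a)
      (expPolicy φ θ x a • (φ x a - meanFeature φ θ x)) θ := by
  have hexp : ∀ b, HasFDerivAt (fun η => Real.exp (inner ℝ (φ x b) η))
      (Real.exp (inner ℝ (φ x b) θ) • innerSL ℝ (φ x b)) θ := fun b =>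
    ((innerSL ℝ (φ x b)).hasFDerivAt (x := θ)).exp
  have hsum : HasFDerivAt (fun η => ∑ b, Real.exp (inner ℝ (φ x b) η))
      (∑ b, Real.exp (inner ℝ (φ x b) θ) • innerSL ℝ (φ x b)) θ :=
    HasFDerivAt.fun_sum fun b _ => hexp b
  have hpos := (sum_exp_inner_pos φ θ x).ne'
  rw [hasGradientAt_iff_hasFDerivAt]
  refine ((hexp a).mul ((hasDerivAt_inv hpos).comp_hasFDerivAt θ hsum)).congr_fderiv ?_
  ext v
  simp only [meanFeature, expPolicy, map_smul, map_sub, map_sum, smul_apply,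
    add_apply, Function.comp_apply, sub_apply, sum_apply, innerSL_apply_apply,
    InnerProductSpace.toDual_apply_apply, smul_eq_mul]
  simp only [div_mul_eq_mul_div, ← Finset.sum_div]
  field_simp
  ring

theorem gradient_expPolicy [Nonempty A] (θ : EuclideanSpace ℝ (Fin d)) (x : X) (a : A) :
    gradient (fun η => expPolicy φ η x a) θ =
      expPolicy φ θ x a • (φ x a - meanFeature φ θ x) :=
  (hasGradientAt_expPolicy φ θ x a).gradient

variable [Nonempty A] {φ}

theorem norm_sum_expPolicy_smul_le {E : Type*} [NormedAddCommGroup E] [NormedSpace ℝ E]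
    (θ : EuclideanSpace ℝ (Fin d)) (x : X)
    {u : A → E} {C : ℝ}
    (hu : ∀ a, ‖u a‖ ≤ C) : ‖∑ a, expPolicy φ θ x a • u a‖ ≤ C := by
  calc _ ≤ ∑ a, expPolicy φ θ x a * C := by
        refine norm_sum_le_of_le _ fun a _ => ?_
        rw [norm_smul, Real.norm_of_nonneg (expPolicy_nonneg φ θ x a)]
        exact mul_le_mul_of_nonneg_left (hu a) (expPolicy_nonneg φ θ x a)
    _ = C := by rw [← Finset.sum_mul, sum_expPolicy, one_mul]

variable {B : ℝ} (hB : ∀ x a, ‖φ x a‖ ≤ B)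
include hB

theorem norm_meanFeature_le (θ : EuclideanSpace ℝ (Fin d)) (x : X) :
    ‖meanFeature φ θ x‖ ≤ B :=
  norm_sum_expPolicy_smul_le θ x (hB x)

theorem norm_feature_sub_meanFeature_le (θ : EuclideanSpace ℝ (Fin d)) (x : X) (a : A) :
    ‖φ x a - meanFeature φ θ x‖ ≤ 2 * B := by
  linarith [norm_sub_le (φ x a) (meanFeature φ θ x), hB x a, norm_meanFeature_le hB θ x]

/-- The weight `π_θ(a|x)` is kept so that summing over actions gives `2B` without a factor `|A|`. -/
theorem norm_gradient_expPolicy_le (θ : EuclideanSpace ℝ (Fin d)) (x : X) (a : A) :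
    ‖gradient (fun η => expPolicy φ η x a) θ‖ ≤ expPolicy φ θ x a * (2 * B) := by
  rw [gradient_expPolicy, norm_smul, Real.norm_of_nonneg (expPolicy_nonneg φ θ x a)]
  exact mul_le_mul_of_nonneg_left (norm_feature_sub_meanFeature_le hB θ x a)
    (expPolicy_nonneg φ θ x a)

/-- Mean value inequality with the gradient bounded by `2B`. Bounding the weight by one here is what
produces `|A|` after summation. -/
theorem abs_expPolicy_sub_le (θ θ' : EuclideanSpace ℝ (Fin d)) (x : X) (a : A) :
    |expPolicy φ θ' x a - expPolicy φ θ x a| ≤ 2 * B * ‖θ - θ'‖ := by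
  have hB0 : 0 ≤ B := (norm_nonneg _).trans (hB x a)
  rw [norm_sub_rev θ θ', ← Real.norm_eq_abs]
  refine convex_univ.norm_image_sub_le_of_norm_hasFDerivWithin_le
    (f := fun η => expPolicy φ η x a)
    (fun η _ => (hasGradientAt_expPolicy φ η x a).hasFDerivAt.hasFDerivWithinAt)
    (fun η _ => ?_) (Set.mem_univ θ) (Set.mem_univ θ')
  rw [LinearIsometryEquiv.norm_map, ← gradient_expPolicy]
  refine (norm_gradient_expPolicy_le hB η x a).trans ?_
  exact mul_le_of_le_one_left (by positivity) (expPolicy_le_one φ η x a)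

theorem sum_abs_expPolicy_sub_le (θ θ' : EuclideanSpace ℝ (Fin d)) (x : X) :
    ∑ a, |expPolicy φ θ' x a - expPolicy φ θ x a| ≤
      2 * B * (Fintype.card A : ℝ) * ‖θ - θ'‖ := by
  refine (Finset.sum_le_sum fun a _ => abs_expPolicy_sub_le hB θ θ' x a).trans_eq ?_
  rw [Finset.sum_const, Finset.card_univ, nsmul_eq_mul]
  ring

theorem norm_sum_expPolicy_smul_sub_le {E : Type*} [NormedAddCommGroup E] [NormedSpace ℝ E]
    (θ θ' : EuclideanSpace ℝ (Fin d)) (x : X) {u : A → E} {C : ℝ} (hu : ∀ a, ‖u a‖ ≤ C) :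
    ‖∑ a, expPolicy φ θ' x a • u a - ∑ a, expPolicy φ θ x a • u a‖ ≤
      2 * B * (Fintype.card A : ℝ) * ‖θ - θ'‖ * C := by
  have hC : 0 ≤ C := (norm_nonneg _).trans (hu (Classical.arbitrary A))
  rw [← Finset.sum_sub_distrib]
  calc _ ≤ ∑ a, |expPolicy φ θ' x a - expPolicy φ θ x a| * C := by
        refine norm_sum_le_of_le _ fun a _ => ?_
        rw [← sub_smul, norm_smul, Real.norm_eq_abs]
        exact mul_le_mul_of_nonneg_left (hu a) (abs_nonneg _)
    _ ≤ _ := by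
        rw [← Finset.sum_mul]
        exact mul_le_mul_of_nonneg_right (sum_abs_expPolicy_sub_le hB θ θ' x) hC

theorem sum_norm_gradient_expPolicy_le (θ : EuclideanSpace ℝ (Fin d)) (x : X) :
    ∑ a, ‖gradient (fun η => expPolicy φ η x a) θ‖ ≤ 2 * B := by
  refine (Finset.sum_le_sum fun a _ => norm_gradient_expPolicy_le hB θ x a).trans_eq ?_
  rw [← Finset.sum_mul, sum_expPolicy, one_mul]

/-- By the product rule for differences, varying the weight costs `4B²|A|` and varying the mean
feature costs `2B²|A|`, per unit of `‖θ - θ'‖`. -/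
theorem sum_norm_gradient_expPolicy_sub_le (θ θ' : EuclideanSpace ℝ (Fin d)) (x : X) :
    ∑ a, ‖gradient (fun η => expPolicy φ η x a) θ' - gradient (fun η => expPolicy φ η x a) θ‖ ≤
      6 * B ^ 2 * (Fintype.card A : ℝ) * ‖θ - θ'‖ := by
  have hB0 : 0 ≤ B := (norm_nonneg _).trans (hB x (Classical.arbitrary A))
  have hm : ‖meanFeature φ θ' x - meanFeature φ θ x‖ ≤
      2 * B * (Fintype.card A : ℝ) * ‖θ - θ'‖ * B :=
    norm_sum_expPolicy_smul_sub_le hB θ θ' x (hB x)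
  calc _ ≤ ∑ a, (|expPolicy φ θ' x a - expPolicy φ θ x a| * (2 * B) +
        expPolicy φ θ x a * (2 * B * (Fintype.card A : ℝ) * ‖θ - θ'‖ * B)) := by
        refine Finset.sum_le_sum fun a _ => ?_
        have key : expPolicy φ θ' x a • (φ x a - meanFeature φ θ' x) -
            expPolicy φ θ x a • (φ x a - meanFeature φ θ x) =
            (expPolicy φ θ' x a - expPolicy φ θ x a) • (φ x a - meanFeature φ θ' x) -
              expPolicy φ θ x a • (meanFeature φ θ' x - meanFeature φ θ x) := by
          module
        rw [gradient_expPolicy, gradient_expPolicy, key]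
        refine (norm_sub_le _ _).trans (add_le_add ?_ ?_)
        · rw [norm_smul, Real.norm_eq_abs]
          exact mul_le_mul_of_nonneg_left (norm_feature_sub_meanFeature_le hB θ' x a)
            (abs_nonneg _)
        · rw [norm_smul, Real.norm_of_nonneg (expPolicy_nonneg φ θ x a)]
          exact mul_le_mul_of_nonneg_left hm (expPolicy_nonneg φ θ x a)
    _ ≤ 2 * B * (Fintype.card A : ℝ) * ‖θ - θ'‖ * (2 * B) +
        2 * B * (Fintype.card A : ℝ) * ‖θ - θ'‖ * B := by
        rw [Finset.sum_add_distrib, ← Finset.sum_mul, ← Finset.sum_mul, sum_expPolicy, one_mul]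
        gcongr
        exact sum_abs_expPolicy_sub_le hB θ θ' x
    _ = _ := by ring

end ExpPolicy

/-! ### Policy-induced kernels and their dependence on the parameter -/

section PolicyKernel

variable {X A E : Type*} [MeasurableSpace X] [Fintype A] [MeasurableSpace A] {d : ℕ}
  [NormedAddCommGroup E] [NormedSpace ℝ E]
  {φ : X → A → EuclideanSpace ℝ (Fin d)} (hφ : ∀ a, Measurable fun x => φ x a)

theorem policyKernel_apply (θ : EuclideanSpace ℝ (Fin d)) (x : X) :
    policyKernel φ hφ θ x =
      ∑ a : A, ENNReal.ofReal (expPolicy φ θ x a) • Measure.dirac a := rfl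

variable [Nonempty A]

instance isMarkovKernel_policyKernel (θ : EuclideanSpace ℝ (Fin d)) :
    IsMarkovKernel (policyKernel φ hφ θ) := by
  refine ⟨fun x => ⟨?_⟩⟩
  rw [policyKernel_apply]
  simp only [Measure.coe_finsetSum, Finset.sum_apply, Measure.smul_apply, smul_eq_mul,
    measure_univ, mul_one]
  rw [← ENNReal.ofReal_sum_of_nonneg fun a _ => expPolicy_nonneg φ θ x a, sum_expPolicy,
    ENNReal.ofReal_one]

instance isMarkovKernel_stateKernel (P : Kernel (X × A) X) [IsMarkovKernel P] (π : Kernel X A)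
    [IsMarkovKernel π] : IsMarkovKernel (stateKernel P π) := by
  unfold stateKernel; infer_instance

instance isMarkovKernel_stateActionKernel (P : Kernel (X × A) X) [IsMarkovKernel P]
    (π : Kernel X A) [IsMarkovKernel π] : IsMarkovKernel (stateActionKernel P π) := by
  unfold stateActionKernel; infer_instance

theorem integral_id_prod_policyKernel [CompleteSpace E] (θ : EuclideanSpace ℝ (Fin d))
    {g : X × A → E} (hg : StronglyMeasurable g) (x : X) :
    ∫ z, g z ∂((Kernel.id ×ₖ policyKernel φ hφ θ) x) =
      ∑ a, expPolicy φ θ x a • g (x, a) := by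
  have hx : StronglyMeasurable fun a => g (x, a) := hg.comp_measurable measurable_prodMk_left
  rw [Kernel.prod_apply, Kernel.id_apply, Measure.dirac_prod,
    integral_map measurable_prodMk_left.aemeasurable hg.aestronglyMeasurable, policyKernel_apply,
    integral_finsetSum_measure]
  · refine Finset.sum_congr rfl fun a _ => ?_
    rw [integral_smul_measure, integral_dirac' _ _ hx,
      ENNReal.toReal_ofReal (expPolicy_nonneg φ θ x a)]
  · intro a _
    exact (integrable_dirac' hx enorm_lt_top).smul_measure ENNReal.ofReal_ne_top

/-- Two policies in the same dynamics thus differ only in the weights, and the softmax estimate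
applies without total variation distances. -/
theorem integral_stateKernel [CompleteSpace E] (P : Kernel (X × A) X) [IsMarkovKernel P]
    (θ : EuclideanSpace ℝ (Fin d)) {g : X → E} (hg : StronglyMeasurable g) {C : ℝ}
    (hC : ∀ x, ‖g x‖ ≤ C) (x : X) :
    ∫ y, g y ∂(stateKernel P (policyKernel φ hφ θ) x) =
      ∑ a, expPolicy φ θ x a • ∫ y, g y ∂(P (x, a)) := by
  rw [stateKernel, Kernel.integral_comp (integrable_of_forall_norm_le _ hg hC)]
  exact integral_id_prod_policyKernel hφ θ hg.integral_kernel x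

theorem integral_stateActionKernel [CompleteSpace E] (P : Kernel (X × A) X) [IsMarkovKernel P]
    (θ : EuclideanSpace ℝ (Fin d)) {g : X × A → E} (hg : StronglyMeasurable g) {C : ℝ}
    (hC : ∀ z, ‖g z‖ ≤ C) (z : X × A) :
    ∫ w, g w ∂(stateActionKernel P (policyKernel φ hφ θ) z) =
      ∫ y, ∑ a, expPolicy φ θ y a • g (y, a) ∂(P z) := by
  rw [stateActionKernel, Kernel.integral_comp (integrable_of_forall_norm_le _ hg hC)]
  simp_rw [integral_id_prod_policyKernel hφ θ hg]

omit [MeasurableSpace A] [Nonempty A] in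
include hφ in
theorem stronglyMeasurable_sum_expPolicy_smul (θ : EuclideanSpace ℝ (Fin d))
    {g : X → A → E} (hg : ∀ a, StronglyMeasurable fun x => g x a) :
    StronglyMeasurable fun x => ∑ a, expPolicy φ θ x a • g x a :=
  Finset.stronglyMeasurable_fun_sum _ fun a _ =>
    (measurable_expPolicy φ hφ θ a).stronglyMeasurable.smul (hg a)

variable {B : ℝ} (hB : ∀ x a, ‖φ x a‖ ≤ B) (P : Kernel (X × A) X) [IsMarkovKernel P] {γ : ℝ}
  (hγ0 : 0 ≤ γ) (hγ1 : γ < 1)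
include hB hγ0 hγ1

/-- The discounted resolvent along the state kernel is Lipschitz in the policy parameter. -/
theorem norm_resolvent_stateKernel_sub_le [CompleteSpace E] (θ θ' : EuclideanSpace ℝ (Fin d))
    {f : X → E} (hf : StronglyMeasurable f) {C : ℝ} (hC : ∀ x, ‖f x‖ ≤ C) (x : X) :
    ‖resolvent (stateKernel P (policyKernel φ hφ θ')) γ f x -
        resolvent (stateKernel P (policyKernel φ hφ θ)) γ f x‖ ≤
      γ * (2 * B * (Fintype.card A : ℝ) * ‖θ - θ'‖ * (C / (1 - γ))) / (1 - γ) := by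
  refine norm_resolvent_sub_resolvent_le _ _ hγ0 hγ1 hf hC (fun y => ?_) x
  have hm := stronglyMeasurable_resolvent (stateKernel P (policyKernel φ hφ θ')) hγ0 hγ1 hf hC
  have hb := norm_resolvent_le (stateKernel P (policyKernel φ hφ θ')) hγ0 hγ1 hC
  rw [integral_stateKernel hφ P θ' hm hb, integral_stateKernel hφ P θ hm hb]
  exact norm_sum_expPolicy_smul_sub_le hB θ θ' y
    fun a => norm_integral_le_of_forall_norm_le _ hb

/-- The discounted resolvent along the state-action kernel is Lipschitz in the policy
parameter. -/
theorem norm_resolvent_stateActionKernel_sub_le [CompleteSpace E]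
    (θ θ' : EuclideanSpace ℝ (Fin d)) {f : X × A → E} (hf : StronglyMeasurable f) {C D : ℝ}
    (hC : ∀ z, ‖f z‖ ≤ C)
    (hD : ∀ z, ‖resolvent (stateActionKernel P (policyKernel φ hφ θ')) γ f z‖ ≤ D) (z : X × A) :
    ‖resolvent (stateActionKernel P (policyKernel φ hφ θ')) γ f z -
        resolvent (stateActionKernel P (policyKernel φ hφ θ)) γ f z‖ ≤
      γ * (2 * B * (Fintype.card A : ℝ) * ‖θ - θ'‖ * D) / (1 - γ) := by
  -- The perturbation acts on the resolvent at `θ'`, so its own bound `D` enters, not `C/(1 - γ)`.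
  -- For action values `D` is `Qmax`.
  refine norm_resolvent_sub_resolvent_le _ _ hγ0 hγ1 hf hC (fun w => ?_) z
  have hm :=
    stronglyMeasurable_resolvent (stateActionKernel P (policyKernel φ hφ θ')) hγ0 hγ1 hf hC
  have hi : ∀ ϑ, Integrable (fun y => ∑ a, expPolicy φ ϑ y a •
      resolvent (stateActionKernel P (policyKernel φ hφ θ')) γ f (y, a)) (P w) := fun ϑ =>
    integrable_of_forall_norm_le _
      (stronglyMeasurable_sum_expPolicy_smul hφ ϑ
        fun a => hm.comp_measurable measurable_prodMk_right)
      fun y => norm_sum_expPolicy_smul_le ϑ y fun a => hD (y, a)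
  rw [integral_stateActionKernel hφ P θ' hm hD, integral_stateActionKernel hφ P θ hm hD,
    ← integral_sub (hi θ') (hi θ)]
  exact norm_integral_le_of_forall_norm_le _ fun y =>
    norm_sum_expPolicy_smul_sub_le hB θ θ' y fun a => hD (y, a)

end PolicyKernel

section ActionValue

variable {X A : Type*} [MeasurableSpace X] [MeasurableSpace A]

theorem actionValue_eq_resolvent (R : Kernel (X × A) ℝ) (P : Kernel (X × A) X) (γ : ℝ)
    (π : Kernel X A) (x : X) (a : A) :
    actionValue R P γ π x a = resolvent (stateActionKernel P π) γ (expReward R) (x, a) := rfl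

theorem stronglyMeasurable_expReward (R : Kernel (X × A) ℝ) :
    StronglyMeasurable (expReward R) :=
  StronglyMeasurable.integral_kernel (κ := R) stronglyMeasurable_id

end ActionValue

/-! ### Lipschitz bounds for the policy gradient -/

section PolicyGradient

variable {X A : Type*} [MeasurableSpace X] [Fintype A] [MeasurableSpace A] {d : ℕ}
  (R : Kernel (X × A) ℝ) (P : Kernel (X × A) X) (γ : ℝ)
  (φ : X → A → EuclideanSpace ℝ (Fin d)) (hφ : ∀ a, Measurable fun x => φ x a)

/-- The integrand `∑_a Q^{π_ϑ}(x,a) ∇π_ϑ(a|x)` of the policy gradient. -/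
noncomputable def policyGradIntegrand (ϑ : EuclideanSpace ℝ (Fin d)) (x : X) :
    EuclideanSpace ℝ (Fin d) :=
  ∑ a : A, actionValue R P γ (policyKernel φ hφ ϑ) x a •
    gradient (fun η => expPolicy φ η x a) ϑ

variable {γ} [Nonempty A] [IsMarkovKernel P] (hγ0 : 0 ≤ γ) (hγ1 : γ < 1)
  {Rmax : ℝ} (hR : ∀ z, |expReward R z| ≤ Rmax)

include hγ0 hγ1 hR in
theorem stronglyMeasurable_policyGradIntegrand (ϑ : EuclideanSpace ℝ (Fin d)) :
    StronglyMeasurable (policyGradIntegrand R P γ φ hφ ϑ) := by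
  refine Finset.stronglyMeasurable_fun_sum _ fun a _ => ?_
  simp_rw [gradient_expPolicy, actionValue_eq_resolvent]
  have hQ := stronglyMeasurable_resolvent (stateActionKernel P (policyKernel φ hφ ϑ)) hγ0 hγ1
    (stronglyMeasurable_expReward R) hR
  exact (hQ.comp_measurable measurable_prodMk_right).smul
    ((measurable_expPolicy φ hφ ϑ a).stronglyMeasurable.smul ((hφ a).stronglyMeasurable.sub
      (stronglyMeasurable_sum_expPolicy_smul hφ ϑ fun b => (hφ b).stronglyMeasurable)))

variable {φ} {B : ℝ} (hB : ∀ x a, ‖φ x a‖ ≤ B) {Qmax : ℝ}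

omit [IsMarkovKernel P] in
include hB in
theorem norm_policyGradIntegrand_le {ϑ : EuclideanSpace ℝ (Fin d)}
    (hQ : ∀ x a, |actionValue R P γ (policyKernel φ hφ ϑ) x a| ≤ Qmax) (x : X) :
    ‖policyGradIntegrand R P γ φ hφ ϑ x‖ ≤ Qmax * (2 * B) := by
  have hQ0 : 0 ≤ Qmax := (abs_nonneg _).trans (hQ x (Classical.arbitrary A))
  calc _ ≤ ∑ a, Qmax * ‖gradient (fun η => expPolicy φ η x a) ϑ‖ := by
        refine norm_sum_le_of_le _ fun a _ => ?_
        rw [norm_smul, Real.norm_eq_abs]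
        exact mul_le_mul_of_nonneg_right (hQ x a) (norm_nonneg _)
    _ ≤ _ := by
        rw [← Finset.mul_sum]
        exact mul_le_mul_of_nonneg_left (sum_norm_gradient_expPolicy_le hB ϑ x) hQ0

include hB hγ0 hγ1 hR in
theorem norm_policyGradIntegrand_sub_le (θ : EuclideanSpace ℝ (Fin d))
    {θ' : EuclideanSpace ℝ (Fin d)}
    (hQ : ∀ x a, |actionValue R P γ (policyKernel φ hφ θ') x a| ≤ Qmax) (x : X) :
    ‖policyGradIntegrand R P γ φ hφ θ' x - policyGradIntegrand R P γ φ hφ θ x‖ ≤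
      Qmax * (6 * B ^ 2 * (Fintype.card A : ℝ) * ‖θ - θ'‖) +
        γ * (2 * B * (Fintype.card A : ℝ) * ‖θ - θ'‖ * Qmax) / (1 - γ) * (2 * B) := by
  have hB0 : 0 ≤ B := (norm_nonneg _).trans (hB x (Classical.arbitrary A))
  have hQ0 : 0 ≤ Qmax := (abs_nonneg _).trans (hQ x (Classical.arbitrary A))
  have h1γ : 0 ≤ 1 - γ := by linarith
  unfold policyGradIntegrand
  rw [← Finset.sum_sub_distrib]
  calc _ ≤ ∑ a, (Qmax * ‖gradient (fun η => expPolicy φ η x a) θ' -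
          gradient (fun η => expPolicy φ η x a) θ‖ +
        γ * (2 * B * (Fintype.card A : ℝ) * ‖θ - θ'‖ * Qmax) / (1 - γ) *
          ‖gradient (fun η => expPolicy φ η x a) θ‖) := by
        refine norm_sum_le_of_le _ fun a _ => ?_
        -- In this splitting `Qmax` is needed only at `θ'`: it bounds the factor `p` and also the
        -- resolvent in the Lipschitz estimate for `p - q`.
        rw [show ∀ (p q : ℝ) (u v : EuclideanSpace ℝ (Fin d)),
          p • u - q • v = p • (u - v) + (p - q) • v from fun p q u v => by module]
        refine (norm_add_le _ _).trans (add_le_add ?_ ?_)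
        · rw [norm_smul, Real.norm_eq_abs]
          exact mul_le_mul_of_nonneg_right (hQ x a) (norm_nonneg _)
        · rw [norm_smul]
          refine mul_le_mul_of_nonneg_right ?_ (norm_nonneg _)
          exact norm_resolvent_stateActionKernel_sub_le hφ hB P hγ0 hγ1 θ θ'
            (stronglyMeasurable_expReward R) hR (fun z => hQ z.1 z.2) (x, a)
    _ ≤ _ := by
        rw [Finset.sum_add_distrib, ← Finset.mul_sum, ← Finset.mul_sum]
        gcongr
        · exact sum_norm_gradient_expPolicy_sub_le hB θ θ' x
        · exact sum_norm_gradient_expPolicy_le hB θ x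

variable (ρ : Measure X) [IsProbabilityMeasure ρ]

include hB hγ0 hγ1 hR in
theorem policyGrad_eq_integral_resolvent {ϑ : EuclideanSpace ℝ (Fin d)}
    (hQ : ∀ x a, |actionValue R P γ (policyKernel φ hφ ϑ) x a| ≤ Qmax) (K : Kernel X X)
    [IsMarkovKernel K] :
    policyGrad R P γ ρ φ hφ ϑ K =
      ∫ x, resolvent K γ (policyGradIntegrand R P γ φ hφ ϑ) x ∂ρ :=
  (hasSum_integral_resolvent K hγ0 hγ1
    (stronglyMeasurable_policyGradIntegrand R P φ hφ hγ0 hγ1 hR ϑ)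
    (norm_policyGradIntegrand_le R P hφ hB hQ) ρ).tsum_eq

include hB hγ0 hγ1 hR in
/-- Lipschitz dependence of the policy gradient on the policy parameter, the state kernel being
fixed. -/
theorem norm_policyGrad_sub_le_of_fixed_kernel {θ θ' : EuclideanSpace ℝ (Fin d)}
    (hQ : ∀ x a, |actionValue R P γ (policyKernel φ hφ θ) x a| ≤ Qmax)
    (hQ' : ∀ x a, |actionValue R P γ (policyKernel φ hφ θ') x a| ≤ Qmax) (K : Kernel X X)
    [IsMarkovKernel K] :
    ‖policyGrad R P γ ρ φ hφ θ' K - policyGrad R P γ ρ φ hφ θ K‖ ≤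
      (Qmax * (6 * B ^ 2 * (Fintype.card A : ℝ) * ‖θ - θ'‖) +
        γ * (2 * B * (Fintype.card A : ℝ) * ‖θ - θ'‖ * Qmax) / (1 - γ) * (2 * B)) /
          (1 - γ) := by
  have hm := stronglyMeasurable_policyGradIntegrand R P φ hφ hγ0 hγ1 hR
  have hb := norm_policyGradIntegrand_le R P hφ hB hQ
  have hb' := norm_policyGradIntegrand_le R P hφ hB hQ'
  rw [policyGrad_eq_integral_resolvent R P hφ hγ0 hγ1 hR hB ρ hQ,
    policyGrad_eq_integral_resolvent R P hφ hγ0 hγ1 hR hB ρ hQ', ← integral_sub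
    (integrable_of_forall_norm_le _ (stronglyMeasurable_resolvent K hγ0 hγ1 (hm θ') hb')
      (norm_resolvent_le K hγ0 hγ1 hb'))
    (integrable_of_forall_norm_le _ (stronglyMeasurable_resolvent K hγ0 hγ1 (hm θ) hb)
      (norm_resolvent_le K hγ0 hγ1 hb))]
  refine norm_integral_le_of_forall_norm_le ρ fun x => ?_
  rw [← resolvent_sub K hγ0 hγ1 (hm θ') (hm θ) hb' hb]
  exact norm_resolvent_le K hγ0 hγ1
    (norm_policyGradIntegrand_sub_le R P hφ hγ0 hγ1 hR hB θ hQ') x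

include hB hγ0 hγ1 hR in
/-- Lipschitz dependence of the policy gradient on the parameter of the state kernel, the
integrand being fixed. -/
theorem norm_policyGrad_stateKernel_sub_le (θ : EuclideanSpace ℝ (Fin d))
    {θ' ϑ : EuclideanSpace ℝ (Fin d)}
    (hQ : ∀ x a, |actionValue R P γ (policyKernel φ hφ ϑ) x a| ≤ Qmax) :
    ‖policyGrad R P γ ρ φ hφ ϑ (stateKernel P (policyKernel φ hφ θ')) -
        policyGrad R P γ ρ φ hφ ϑ (stateKernel P (policyKernel φ hφ θ))‖ ≤
      γ * (2 * B * (Fintype.card A : ℝ) * ‖θ - θ'‖ * (Qmax * (2 * B) / (1 - γ))) /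
        (1 - γ) := by
  have hm := stronglyMeasurable_policyGradIntegrand R P φ hφ hγ0 hγ1 hR ϑ
  have hb := norm_policyGradIntegrand_le R P hφ hB hQ
  have hi : ∀ (K : Kernel X X) [IsMarkovKernel K],
      Integrable (resolvent K γ (policyGradIntegrand R P γ φ hφ ϑ)) ρ := fun K _ =>
    integrable_of_forall_norm_le _ (stronglyMeasurable_resolvent K hγ0 hγ1 hm hb)
      (norm_resolvent_le K hγ0 hγ1 hb)
  rw [policyGrad_eq_integral_resolvent R P hφ hγ0 hγ1 hR hB ρ hQ,
    policyGrad_eq_integral_resolvent R P hφ hγ0 hγ1 hR hB ρ hQ, ← integral_sub (hi _) (hi _)]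
  exact norm_integral_le_of_forall_norm_le ρ fun x =>
    norm_resolvent_stateKernel_sub_le hφ hB P hγ0 hγ1 θ θ' hm hb x

end PolicyGradient

/-- One kernel change and two integrand changes give the bracket `12 + 12γ/(1 - γ)`. Since `n ≥ 1`,
`12 ≤ 4(1 + 2n)`; the slack is the term with `n - 1`. -/
theorem perturbation_constant_le {γ B Q n t : ℝ} (hγ0 : 0 ≤ γ) (hγ1 : γ < 1) (hQ : 0 ≤ Q)
    (hn : 1 ≤ n) (ht : 0 ≤ t) :
    γ * (2 * B * n * t * (Q * (2 * B) / (1 - γ))) / (1 - γ) +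
      2 * ((Q * (6 * B ^ 2 * n * t) + γ * (2 * B * n * t * Q) / (1 - γ) * (2 * B)) / (1 - γ)) ≤
    Q * B ^ 2 * n / (1 - γ) * (12 + 4 * γ * (1 + 2 * n) / (1 - γ)) * t := by
  have h : 0 < 1 - γ := by linarith
  have key : Q * B ^ 2 * n / (1 - γ) * (12 + 4 * γ * (1 + 2 * n) / (1 - γ)) * t -
      (γ * (2 * B * n * t * (Q * (2 * B) / (1 - γ))) / (1 - γ) +
      2 * ((Q * (6 * B ^ 2 * n * t) + γ * (2 * B * n * t * Q) / (1 - γ) * (2 * B)) / (1 - γ))) =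
      8 * γ * Q * B ^ 2 * n * t * (n - 1) / (1 - γ) ^ 2 := by
    field_simp
    ring
  have : 0 ≤ 8 * γ * Q * B ^ 2 * n * t * (n - 1) / (1 - γ) ^ 2 := by
    have : 0 ≤ n - 1 := by linarith
    positivity
  linarith

end PAML

theorem mainTheorem6
    {X A : Type*} [MeasurableSpace X]
    [Fintype A] [Nonempty A] [MeasurableSpace A] [MeasurableSingletonClass A] {d : ℕ}
    -- the discounted MDP: reward distribution, transition kernel, discount factor
    (R : Kernel (X × A) ℝ) [IsMarkovKernel R] (P : Kernel (X × A) X) [IsMarkovKernel P]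
    (γ : ℝ) (hγ0 : 0 ≤ γ) (hγ1 : γ < 1)
    (hRint : ∀ z, Integrable (fun u : ℝ => u) (R z))
    (hRbdd : ∃ Rmax : ℝ, ∀ z, |PAML.expReward R z| ≤ Rmax)
    -- the initial state distribution and the learned model
    (ρ : Measure X) [IsProbabilityMeasure ρ]
    (Phat : Kernel (X × A) X) [IsMarkovKernel Phat]
    -- the exponential policy class with bounded features
    (φ : X → A → EuclideanSpace ℝ (Fin d)) (hφ : ∀ a, Measurable fun x => φ x a)
    (B : ℝ) (hB : IsLUB (Set.range fun z : X × A => ‖φ z.1 z.2‖) B)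
    (Θ : Set (EuclideanSpace ℝ (Fin d)))
    -- the action-value functions of all policies of the class are bounded
    (Qmax : ℝ) (hQ : ∀ ϑ ∈ Θ, ∀ x a,
      |PAML.actionValue R P γ (PAML.policyKernel φ hφ ϑ) x a| ≤ Qmax)
    (θ θ' : EuclideanSpace ℝ (Fin d)) (hθ : θ ∈ Θ) (hθ' : θ' ∈ Θ)
    -- the error at `θ` of the model
    (εmodel : ℝ) (hε : PAML.pamlLoss R P Phat γ ρ φ hφ θ ≤ εmodel) :
    ‖PAML.policyGrad R P γ ρ φ hφ θ' (PAML.stateKernel P (PAML.policyKernel φ hφ θ')) -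
        PAML.policyGrad R P γ ρ φ hφ θ' (PAML.stateKernel Phat (PAML.policyKernel φ hφ θ))‖ ≤
      εmodel +
        Qmax * B ^ 2 * (Fintype.card A : ℝ) / (1 - γ) *
          (12 + 4 * γ * (1 + 2 * (Fintype.card A : ℝ)) / (1 - γ)) * ‖θ - θ'‖ := by
  have hB' : ∀ x a, ‖φ x a‖ ≤ B := fun x a => hB.1 ⟨(x, a), rfl⟩
  obtain ⟨Rmax, hR⟩ := hRbdd
  have hX : Nonempty X := nonempty_of_isProbabilityMeasure ρ
  have hQ0 : 0 ≤ Qmax :=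
    (abs_nonneg _).trans (hQ θ hθ (Classical.arbitrary X) (Classical.arbitrary A))
  have hcard : (1 : ℝ) ≤ (Fintype.card A : ℝ) := by exact_mod_cast Fintype.card_pos (α := A)
  have h1 := PAML.norm_policyGrad_stateKernel_sub_le R P hφ hγ0 hγ1 hR hB' ρ θ (θ' := θ')
    (hQ θ' hθ')
  have h2 := PAML.norm_policyGrad_sub_le_of_fixed_kernel R P hφ hγ0 hγ1 hR hB' ρ
    (hQ θ hθ) (hQ θ' hθ') (PAML.stateKernel P (PAML.policyKernel φ hφ θ))
  have h3 := PAML.norm_policyGrad_sub_le_of_fixed_kernel R P hφ hγ0 hγ1 hR hB' ρ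
    (hQ θ hθ) (hQ θ' hθ') (PAML.stateKernel Phat (PAML.policyKernel φ hφ θ))
  rw [norm_sub_rev] at h3
  have h4 := PAML.perturbation_constant_le (B := B) hγ0 hγ1 hQ0 hcard (norm_nonneg (θ - θ'))
  unfold PAML.pamlLoss at hε
  -- The intermediate gradients are `(θ', P^{π_θ})`, `(θ, P^{π_θ})` and `(θ, Phat^{π_θ})`; the
  -- middle gap is the model error.
  refine (norm_sub_le_norm_sub_add_norm_sub _
    (PAML.policyGrad R P γ ρ φ hφ θ' (PAML.stateKernel P (PAML.policyKernel φ hφ θ))) _).trans ?_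
  have h5 := norm_sub_le_norm_sub_add_norm_sub
    (PAML.policyGrad R P γ ρ φ hφ θ' (PAML.stateKernel P (PAML.policyKernel φ hφ θ)))
    (PAML.policyGrad R P γ ρ φ hφ θ (PAML.stateKernel P (PAML.policyKernel φ hφ θ)))
    (PAML.policyGrad R P γ ρ φ hφ θ' (PAML.stateKernel Phat (PAML.policyKernel φ hφ θ)))
  have h6 := norm_sub_le_norm_sub_add_norm_sub
    (PAML.policyGrad R P γ ρ φ hφ θ (PAML.stateKernel P (PAML.policyKernel φ hφ θ)))
    (PAML.policyGrad R P γ ρ φ hφ θ (PAML.stateKernel Phat (PAML.policyKernel φ hφ θ)))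
    (PAML.policyGrad R P γ ρ φ hφ θ' (PAML.stateKernel Phat (PAML.policyKernel φ hφ θ)))
  linarith
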